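/- Let $K\ge 1$ and let $\mathcal S\subset\mathbb R^q$ be any subset. A $K$-state hidden Markov model with parameters $(\Gamma;F_1,\dots,F_K)$ consists of a time-homogeneous Markov chain $(X_t)_{t\in\mathbb N}$ with values in $\{1,\dots,K\}$ and transition probability matrix $\Gamma$, and of $\mathcal S$-valued observations $(Y_t)_{t\in\mathbb N}$ that are conditionally independent given $(X_t)_{t\in\mathbb N}$, such that the conditional distribution of $Y_s$ given $(X_t)_{t\in\mathbb N}$ is $F_{X_s}$, where the state-dependent distributions $F_1,\dots,F_K$ are probability distributions on $\mathcal S$ (Borel $\sigma$-algebra). Consider the following assumptions: 1. $\Gamma$ has full rank $K$ and is ergodic (irreducible and aperiodic); 2. $F_1,\dots,F_K$ are pairwise distinct; 3. $(X_t)$ is stationary, i.e. $X_1$ is distributed according to the stationary distribution $\pi$ of $\Gamma$. Proposition. For known $K$, the parameters $\Gamma$ and $F_1,\dots,F_K$ are identified, up to label swapping, from the joint distribution of $(Y_1,\dots,Y_{2K+1})$ within the class of parameters satisfying Assumptions 1–3. That is: if two $K$-state hidden Markov models with values in $\mathcal S$, with parameters $(\Gamma;F_1,\dots,F_K)$ and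 $(\Gamma';F'_1,\dots,F'_K)$, both satisfy Assumptions 1–3 and give the same joint distribution of $(Y_1,\dots,Y_{2K+1})$, then there is a permutation $\sigma$ of $\{1,\dots,K\}$ such that $F'_k=F_{\sigma(k)}$ and $\Gamma'_{jk}=\Gamma_{\sigma(j)\sigma(k)}$ for all $j,k\in\{1,\dots,K\}$. -/

import Mathlib

open MeasureTheory ProbabilityTheory

/-- Label swapping: the parameters `(Γ', F')` arise from `(Γ, F)` by a permutation of the labels
of the `K` states. -/
def EqualUpToLabelSwapping {K : ℕ} {S : Type*} [MeasurableSpace S]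
    (Γ : Matrix (Fin K) (Fin K) ℝ) (F : Fin K → Measure S)
    (Γ' : Matrix (Fin K) (Fin K) ℝ) (F' : Fin K → Measure S) : Prop :=
  ∃ σ : Equiv.Perm (Fin K),
    (∀ j k, Γ' j k = Γ (σ j) (σ k)) ∧ ∀ k, F' k = F (σ k)

/-- A transition matrix is aperiodic if, for every state `i`, the return times to `i`, that is the
`n ≥ 1` with `(Γ ^ n) i i > 0`, have greatest common divisor `1`. -/
def IsAperiodicMatrix {K : ℕ} (Γ : Matrix (Fin K) (Fin K) ℝ) : Prop :=
  ∀ (i : Fin K) (d : ℕ), (∀ n : ℕ, 1 ≤ n → 0 < (Γ ^ n) i i → d ∣ n) → d = 1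

/-- Ergodicity of a finite transition matrix: irreducible and aperiodic. -/
def IsErgodicMatrix {K : ℕ} (Γ : Matrix (Fin K) (Fin K) ℝ) : Prop :=
  Γ.IsIrreducible ∧ IsAperiodicMatrix Γ

/-- `p` is a stationary distribution of `Γ`: a probability vector with `p Γ = p`. -/
structure IsStationaryDistribution {K : ℕ} (Γ : Matrix (Fin K) (Fin K) ℝ) (p : Fin K → ℝ) :
    Prop where
  nonneg : ∀ k, 0 ≤ p k
  sum_eq_one : ∑ k, p k = 1
  vecMul_eq : Matrix.vecMul p Γ = p

/-- `X 0, X 1, X 2, …` is a time-homogeneous Markov chain on `Fin K` with transition probability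
matrix `Γ` and some starting distribution. The Markov property is written in the multiplied-out form
`pr (X_{n+1} = x_{n+1}, X_n = x_n, …, X_0 = x_0) = pr (X_n = x_n, …, X_0 = x_0) Γ x_n x_{n+1}`. -/
structure IsMarkovChain {K : ℕ} {Ω : Type*} [MeasurableSpace Ω]
    (Γ : Matrix (Fin K) (Fin K) ℝ) (μ : Measure Ω) (X : ℕ → Ω → Fin K) : Prop where
  stochastic : Γ ∈ Matrix.rowStochastic ℝ (Fin K)
  measurable : ∀ t, Measurable (X t)
  markov : ∀ (n : ℕ) (x : ℕ → Fin K),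
    μ.real {ω | ∀ i ≤ n + 1, X i ω = x i} =
      μ.real {ω | ∀ i ≤ n, X i ω = x i} * Γ (x n) (x (n + 1))

/-- The σ-algebra generated by the whole process `(X t)_{t ∈ ℕ}`. -/
abbrev processSigma {K : ℕ} {Ω : Type*} (X : ℕ → Ω → Fin K) : MeasurableSpace Ω :=
  ⨆ t, MeasurableSpace.comap (X t) inferInstance

/-- `(X t, Y t)_{t ∈ ℕ}` is a `K`-state hidden Markov model under `μ`, with transition matrix `Γ` and
state-dependent distributions `F k`: the latent process `X` is a time-homogeneous Markov chain, the
`Y t` are conditionally independent given `(X t)_{t ∈ ℕ}`, and the conditional distribution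
of `Y t` given `(X t)_{t ∈ ℕ}` is `F (X t)`. Times start at `0` instead of `1`. -/
structure IsHiddenMarkovModel {K : ℕ} {S : Type*} [MeasurableSpace S]
    {Ω : Type*} [MeasurableSpace Ω]
    (Γ : Matrix (Fin K) (Fin K) ℝ) (F : Fin K → Measure S) (μ : Measure Ω)
    (X : ℕ → Ω → Fin K) (Y : ℕ → Ω → S) : Prop where
  isProbabilityMeasure : ∀ k, IsProbabilityMeasure (F k)
  markovChain : IsMarkovChain Γ μ X
  measurable : ∀ t, Measurable (Y t)
  condIndep : ∀ (s : Finset ℕ) (B : ℕ → Set S), (∀ t, MeasurableSet (B t)) →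
    μ⟦⋂ t ∈ s, Y t ⁻¹' B t | processSigma X⟧
      =ᵐ[μ] fun ω => ∏ t ∈ s, (μ⟦Y t ⁻¹' B t | processSigma X⟧) ω
  condDistrib : ∀ (t : ℕ) (B : Set S), MeasurableSet B →
    μ⟦Y t ⁻¹' B | processSigma X⟧ =ᵐ[μ] fun ω => (F (X t ω)).real B

/-- The first assumption: the transition matrix has full rank and is ergodic. -/
def FullRankErgodic {K : ℕ} (Γ : Matrix (Fin K) (Fin K) ℝ) : Prop :=
  Γ.rank = K ∧ IsErgodicMatrix Γ

/-- The third assumption: the starting distribution of the chain is the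
stationary distribution of `Γ`. -/
def StartsStationary {K : ℕ} {Ω : Type*} [MeasurableSpace Ω]
    (Γ : Matrix (Fin K) (Fin K) ℝ) (μ : Measure Ω) (X : ℕ → Ω → Fin K) : Prop :=
  IsStationaryDistribution Γ fun k => μ.real (X 0 ⁻¹' {k})

section

open Matrix

/-! ### Path sums of the latent chain as matrix products -/

section MarkovChain

variable {K : ℕ} {Ω : Type*} [MeasurableSpace Ω] {Γ : Matrix (Fin K) (Fin K) ℝ} {μ : Measure Ω}
  {X : ℕ → Ω → Fin K}

/-! Let `D(A)` be the diagonal matrix of the `F k A`, and `M(A) = D(A) Γ`. Conditioning on the chain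
gives `P(Y_0 ∈ A_0, …, Y_{n-1} ∈ A_{n-1}) = π M(A_0) ⋯ M(A_{n-1}) 1`: the law is a word function
over the alphabet of measurable sets, realized linearly in dimension `K`.

This realization is minimal: the vectors `M(w) 1`, and likewise the `π M(w)`, with `w` of length `K`
span `ℝ ^ K` (`Matrix.span_forward_words_eq_top`, `Matrix.span_backward_words_eq_top`). Here
invertibility of `Γ`, positivity of `π` and distinctness of the `F k` enter. Choosing `K` prefixes
and `K` suffixes gives invertible `U`, `V`. Words of length at most `2K + 1` determine `U V` and `U
M(A) V`, so `T = U⁻¹ U'` satisfies `M(A) T = T M'(A)` and `T 1 = 1`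
(`Matrix.exists_isUnit_intertwining`).

The sure event gives `Γ T = T Γ'`; cancelling `Γ'` leaves `D(A) T = T D'(A)`. A nonzero entry `T j
k` thus forces `F j = F' k`, so `T` is a permutation matrix
(`Matrix.exists_perm_of_diagonal_intertwining`). -/

lemma IsMarkovChain.measureReal_path_snoc (h : IsMarkovChain Γ μ X) {n : ℕ}
    (x : Fin (n + 1) → Fin K) (y : Fin K) :
    μ.real {ω | ∀ i : Fin (n + 2), X i ω = (Fin.snoc x y : Fin (n + 2) → Fin K) i} =
      μ.real {ω | ∀ i : Fin (n + 1), X i ω = x i} * Γ (x (Fin.last n)) y := by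
  -- The finite path is extended to all of `ℕ` modulo `n + 2`; only the indices up to `n + 1`
  -- matter.
  have key := h.markov n fun i => (Fin.snoc x y : Fin (n + 2) → Fin K) (Fin.ofNat (n + 2) i)
  have hcast : ∀ i : Fin (n + 1), Fin.ofNat (n + 2) (i : ℕ) = i.castSucc := fun i => by
    ext; simp
  have hlast : Fin.ofNat (n + 2) (n + 1) = Fin.last (n + 1) := by
    ext; simp
  have hn : Fin.ofNat (n + 2) n = (Fin.last n).castSucc := by
    simpa using hcast (Fin.last n)
  have e1 : {ω | ∀ i ≤ n + 1, X i ω =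
      (Fin.snoc x y : Fin (n + 2) → Fin K) (Fin.ofNat (n + 2) i)} =
      {ω | ∀ i : Fin (n + 2), X i ω = (Fin.snoc x y : Fin (n + 2) → Fin K) i} := by
    ext ω
    refine ⟨fun H i => ?_, fun H i hi => ?_⟩
    · simpa using H i (by omega)
    · have := H (Fin.ofNat (n + 2) i)
      simpa [Nat.mod_eq_of_lt (show i < n + 2 by omega)] using this
  have e2 : {ω | ∀ i ≤ n, X i ω = (Fin.snoc x y : Fin (n + 2) → Fin K) (Fin.ofNat (n + 2) i)} =
      {ω | ∀ i : Fin (n + 1), X i ω = x i} := by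
    ext ω
    refine ⟨fun H i => ?_, fun H i hi => ?_⟩
    · have := H i (by omega)
      rwa [hcast, Fin.snoc_castSucc] at this
    · have := H ⟨i, by omega⟩
      have h2 := hcast ⟨i, by omega⟩
      simp only at h2 this
      rwa [h2, Fin.snoc_castSucc]
  rw [e1, e2] at key
  simp only [hlast, hn, Fin.snoc_last, Fin.snoc_castSucc] at key
  exact key

/-- The free end function `g` makes the induction work: summing out the last state replaces `g` by
`diagonal (f n) * Γ` applied to `g`. -/
lemma IsMarkovChain.sum_path_eq_dotProduct (h : IsMarkovChain Γ μ X) (f : ℕ → Fin K → ℝ)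
    (n : ℕ) (g : Fin K → ℝ) :
    ∑ x : Fin (n + 1) → Fin K, μ.real {ω | ∀ i : Fin (n + 1), X i ω = x i} *
        ((∏ i : Fin n, f i (x i.castSucc)) * g (x (Fin.last n))) =
      (fun k => μ.real (X 0 ⁻¹' {k})) ⬝ᵥ
        (((List.range n).map fun t => diagonal (f t) * Γ).prod *ᵥ g) := by
  induction n generalizing g with
  | zero =>
    rw [← (Equiv.funUnique (Fin 1) (Fin K)).symm.sum_comp]
    simp [dotProduct, Set.preimage]
  | succ n ih =>
    rw [List.range_succ, List.map_append, List.prod_append, ← mulVec_mulVec, ← ih,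
      ← (Fin.snocEquiv fun _ => Fin K).sum_comp, Fintype.sum_prod_type_right]
    refine Finset.sum_congr rfl fun x _ => ?_
    simp only [Fin.snocEquiv, Equiv.coe_fn_mk, h.measureReal_path_snoc, Fin.snoc_castSucc,
      Fin.snoc_last, Fin.prod_univ_castSucc, List.map_cons, List.map_nil, List.prod_singleton,
      ← mulVec_mulVec, mulVec_diagonal]
    simp only [mulVec, dotProduct, Finset.mul_sum, Fin.val_castSucc, Fin.val_last]
    refine Finset.sum_congr rfl fun y _ => ?_
    ring

lemma IsMarkovChain.integral_prod_eq_dotProduct [IsProbabilityMeasure μ] (h : IsMarkovChain Γ μ X)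
    (f : ℕ → Fin K → ℝ) (n : ℕ) :
    ∫ ω, ∏ t ∈ Finset.range n, f t (X t ω) ∂μ =
      (fun k => μ.real (X 0 ⁻¹' {k})) ⬝ᵥ
        (((List.range n).map fun t => diagonal (f t) * Γ).prod *ᵥ 1) := by
  have hmeas : Measurable fun ω (i : Fin (n + 1)) => X i ω :=
    measurable_pi_lambda _ fun i => h.measurable i
  rw [← h.sum_path_eq_dotProduct f n 1]
  have e : ∀ ω, ∏ t ∈ Finset.range n, f t (X t ω) =
      (fun x : Fin (n + 1) → Fin K => ∏ i : Fin n, f i (x i.castSucc))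
        (fun i : Fin (n + 1) => X i ω) := fun ω => by
    simp [Finset.prod_range]
  simp_rw [e]
  rw [← integral_map (φ := fun ω (i : Fin (n + 1)) => X i ω)
    (f := fun x : Fin (n + 1) → Fin K => ∏ i : Fin n, f i (x i.castSucc)) hmeas.aemeasurable
    (Measurable.of_discrete.aestronglyMeasurable)]
  have := Measure.isProbabilityMeasure_map (μ := μ) hmeas.aemeasurable
  rw [integral_fintype Integrable.of_finite]
  refine Finset.sum_congr rfl fun x _ => ?_
  rw [map_measureReal_apply hmeas (measurableSet_singleton x)]
  simp only [smul_eq_mul, Pi.one_apply, mul_one]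
  congr 2
  ext ω
  simp [funext_iff]

end MarkovChain

/-! ### Observation probabilities as a word function -/

section Emission

variable {K : ℕ} {S : Type*} [MeasurableSpace S]

/-- The matrix with entries `F i A * Γ i j`: emission of a value in `A`, followed by one step of
the chain. -/
noncomputable def emissionStep (Γ : Matrix (Fin K) (Fin K) ℝ) (F : Fin K → Measure S)
    (A : {A : Set S // MeasurableSet A}) : Matrix (Fin K) (Fin K) ℝ :=
  diagonal (fun k => (F k).real A) * Γ

variable {Ω : Type*} [MeasurableSpace Ω] {Γ : Matrix (Fin K) (Fin K) ℝ} {F : Fin K → Measure S}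
  {μ : Measure Ω} [IsProbabilityMeasure μ] {X : ℕ → Ω → Fin K} {Y : ℕ → Ω → S}

lemma IsHiddenMarkovModel.measureReal_iInter_preimage (h : IsHiddenMarkovModel Γ F μ X Y)
    (B : ℕ → {A : Set S // MeasurableSet A}) (n : ℕ) :
    μ.real (⋂ t ∈ Finset.range n, Y t ⁻¹' B t) =
      (fun k => μ.real (X 0 ⁻¹' {k})) ⬝ᵥ
        (((List.range n).map fun t => emissionStep Γ F (B t)).prod *ᵥ 1) := by
  have hm : processSigma X ≤ ‹MeasurableSpace Ω› :=
    iSup_le fun t => (h.markovChain.measurable t).comap_le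
  have hset : MeasurableSet (⋂ t ∈ Finset.range n, Y t ⁻¹' (B t : Set S)) :=
    Finset.measurableSet_biInter _ fun t _ => h.measurable t (B t).2
  have h1 : μ⟦⋂ t ∈ Finset.range n, Y t ⁻¹' (B t : Set S) | processSigma X⟧ =ᵐ[μ]
      fun ω => ∏ t ∈ Finset.range n, (F (X t ω)).real (B t) := by
    have h2 : ∀ᵐ ω ∂μ, ∀ t, (μ⟦Y t ⁻¹' (B t : Set S) | processSigma X⟧) ω =
        (F (X t ω)).real (B t) :=
      ae_all_iff.2 fun t => h.condDistrib t _ (B t).2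
    filter_upwards [h.condIndep (Finset.range n) (fun t => B t) fun t => (B t).2, h2] with ω a b
    rw [a]
    exact Finset.prod_congr rfl fun t _ => b t
  calc μ.real (⋂ t ∈ Finset.range n, Y t ⁻¹' (B t : Set S))
      = ∫ ω, (μ⟦⋂ t ∈ Finset.range n, Y t ⁻¹' (B t : Set S) | processSigma X⟧) ω ∂μ := by
        rw [integral_condExp hm, integral_indicator hset]
        simp
    _ = ∫ ω, ∏ t ∈ Finset.range n, (F (X t ω)).real (B t) ∂μ := integral_congr_ae h1
    _ = _ := h.markovChain.integral_prod_eq_dotProduct (fun t k => (F k).real (B t)) n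

/-- The probability of a word of at most `N` observation events, in terms of the joint law of
the first `N` observations. -/
lemma IsHiddenMarkovModel.map_measureReal_eq_dotProduct (h : IsHiddenMarkovModel Γ F μ X Y)
    {N : ℕ} (w : List {A : Set S // MeasurableSet A}) (hw : w.length ≤ N) :
    (μ.map fun ω (i : Fin N) => Y i ω).real
        {y | ∀ i : Fin N, y i ∈ (w.getD i ⟨Set.univ, .univ⟩ : Set S)} =
      (fun k => μ.real (X 0 ⁻¹' {k})) ⬝ᵥ ((w.map (emissionStep Γ F)).prod *ᵥ 1) := by
  have key := h.measureReal_iInter_preimage (fun t => w.getD t ⟨Set.univ, .univ⟩) w.length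
  have hlist : (List.range w.length).map
      (fun t => emissionStep Γ F (w.getD t ⟨Set.univ, .univ⟩)) = w.map (emissionStep Γ F) := by
    refine List.ext_getElem (by simp) fun i h1 h2 => ?_
    have : i < w.length := by simpa using h1
    simp [this]
  rw [hlist] at key
  rw [← key, map_measureReal_apply (measurable_pi_lambda _ fun i : Fin N => h.measurable i)]
  · congr 1
    ext ω
    simp only [Set.mem_preimage, Set.mem_ofPred_eq, Set.mem_iInter, Finset.mem_range]
    refine ⟨fun H i hi => H ⟨i, hi.trans_le hw⟩, fun H i => ?_⟩
    rcases lt_or_ge (i : ℕ) w.length with hi | hi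
    · exact H i hi
    · rw [List.getD_eq_default _ _ hi]
      trivial
  · rw [Set.ofPred_forall]
    exact MeasurableSet.iInter fun i => measurable_pi_apply i (Subtype.prop _)

end Emission

/-! ### Spanning criteria -/

section LinearAlgebra

variable {K : ℕ} {ι : Type*}

/-- An increasing sequence of subspaces which only stops growing at the whole space fills the whole
space after `finrank` many steps. -/
lemma Submodule.eq_top_of_stable {E : Type*} [AddCommGroup E] [Module ℝ E]
    [FiniteDimensional ℝ E] (V : ℕ → Submodule ℝ E) (hmono : ∀ n, V n ≤ V (n + 1))
    (hstable : ∀ n, V (n + 1) = V n → V n = ⊤) : V (Module.finrank ℝ E) = ⊤ := by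
  have key : ∀ n, V n = ⊤ ∨ n ≤ Module.finrank ℝ (V n) := by
    intro n
    induction n with
    | zero => exact Or.inr (Nat.zero_le _)
    | succ n ih =>
      by_cases hn : V n = ⊤
      · exact Or.inl (top_le_iff.1 (hn ▸ hmono n))
      · have hlt : V n < V (n + 1) :=
          lt_of_le_of_ne (hmono n) fun h => hn (hstable n h.symm)
        have := Submodule.finrank_lt_finrank_of_lt hlt
        exact Or.inr (by have := ih.resolve_left hn; omega)
  rcases key (Module.finrank ℝ E) with h | h
  · exact h
  · exact Submodule.eq_top_of_finrank_eq (le_antisymm (Submodule.finrank_le _) h)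

/-- A space of functions on a finite set which contains a nowhere vanishing function and is stable
under multiplication by a point-separating family is everything. -/
lemma Submodule.eq_top_of_mul_mem {d : ι → Fin K → ℝ}
    (hsep : ∀ i j, i ≠ j → ∃ a, d a i ≠ d a j) {W : Submodule ℝ (Fin K → ℝ)}
    {v : Fin K → ℝ} (hv : ∀ k, v k ≠ 0) (hvW : v ∈ W) (hW : ∀ a, ∀ w ∈ W, d a * w ∈ W) :
    W = ⊤ := by
  -- The multipliers of `W` form an algebra containing the separating family, hence, by Lagrange
  -- interpolation, every indicator of a point.
  let 𝒜 : Subalgebra ℝ (Fin K → ℝ) :=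
    { carrier := {f | ∀ w ∈ W, f * w ∈ W}
      mul_mem' := fun {f g} hf hg w hw => by rw [mul_assoc]; exact hf _ (hg _ hw)
      add_mem' := fun {f g} hf hg w hw => by rw [add_mul]; exact W.add_mem (hf _ hw) (hg _ hw)
      algebraMap_mem' := fun r w hw => by
        rw [← Algebra.smul_def]; exact W.smul_mem r hw }
  have hd : ∀ a, d a ∈ 𝒜 := hW
  have hsingle : ∀ k, Pi.single k (1 : ℝ) ∈ W := by
    intro k
    have hex : ∀ j, ∃ f ∈ 𝒜, f k = 1 ∧ (j ≠ k → f j = 0) := by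
      intro j
      by_cases hjk : j = k
      · exact ⟨1, 𝒜.one_mem, rfl, fun h => absurd hjk h⟩
      · obtain ⟨a, ha⟩ := hsep j k hjk
        have hne : d a k - d a j ≠ 0 := sub_ne_zero.2 ha.symm
        refine ⟨(d a k - d a j)⁻¹ • (d a - algebraMap ℝ _ (d a j)),
          𝒜.smul_mem (𝒜.sub_mem (hd a) (𝒜.algebraMap_mem _)) _, ?_, fun _ => ?_⟩
        · simp [hne]
        · simp
    choose f hf hf1 hf0 using hex
    have hprod : ∏ j, f j ∈ 𝒜 := 𝒜.prod_mem fun j _ => hf j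
    have := W.smul_mem (v k)⁻¹ (hprod v hvW)
    convert this using 1
    ext j
    by_cases hjk : j = k
    · subst hjk
      simp [Finset.prod_apply, hf1, hv]
    · have : (∏ i, f i) j = 0 := by
        rw [Finset.prod_apply]
        exact Finset.prod_eq_zero (Finset.mem_univ j) (hf0 j hjk)
      simp [this, hjk]
  rw [eq_top_iff]
  intro x _
  rw [pi_eq_sum_univ' x]
  exact W.sum_mem fun k _ => W.smul_mem _ (by
    convert hsingle k using 1)

/-- A subspace mapped into itself by an invertible matrix is mapped onto itself. -/
lemma Matrix.exists_mulVec_eq_of_mapsTo {Γ : Matrix (Fin K) (Fin K) ℝ} (hΓ : IsUnit Γ)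
    {W : Submodule ℝ (Fin K → ℝ)} (hW : ∀ w ∈ W, Γ *ᵥ w ∈ W) {w : Fin K → ℝ} (hw : w ∈ W) :
    ∃ u ∈ W, Γ *ᵥ u = w := by
  have hinj : Function.Injective (Γ.mulVecLin.restrict hW) := fun x y hxy =>
    Subtype.ext (mulVec_injective_iff_isUnit.2 hΓ (congrArg Subtype.val hxy))
  obtain ⟨u, hu⟩ := LinearMap.surjective_of_injective hinj ⟨w, hw⟩
  exact ⟨u, u.2, congrArg Subtype.val hu⟩

/-- Vectors indexed by words which arise from `v` by applying matrices letter by letter span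
the whole space as soon as the words have length `K`. -/
lemma Matrix.span_words_eq_top (M : ι → Matrix (Fin K) (Fin K) ℝ)
    (u : List ι → Fin K → ℝ) (hu : ∀ a w, u (a :: w) = M a *ᵥ u w) (e : ι)
    (he : M e *ᵥ u [] = u [])
    (htop : ∀ W : Submodule ℝ (Fin K → ℝ), u [] ∈ W → (∀ a, ∀ w ∈ W, M a *ᵥ w ∈ W) → W = ⊤) :
    Submodule.span ℝ (u '' {w | w.length = K}) = ⊤ := by
  let V : ℕ → Submodule ℝ (Fin K → ℝ) := fun n => Submodule.span ℝ (u '' {w | w.length = n})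
  have hstep : ∀ n a, ∀ w ∈ V n, M a *ᵥ w ∈ V (n + 1) := by
    intro n a w hw
    have : V n ≤ (V (n + 1)).comap (M a).mulVecLin := by
      refine Submodule.span_le.2 ?_
      rintro _ ⟨z, hz, rfl⟩
      exact Submodule.subset_span ⟨a :: z, by simpa using hz, hu a z⟩
    exact this hw
  -- Words can be lengthened for free by inserting `e` at the innermost place, where it fixes `u
  -- []`.
  have hmono : ∀ n, V n ≤ V (n + 1) := by
    intro n
    induction n with
    | zero =>
      refine Submodule.span_le.2 ?_
      rintro _ ⟨z, hz, rfl⟩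
      obtain rfl : z = [] := List.length_eq_zero_iff.1 hz
      exact Submodule.subset_span ⟨[e], rfl, by rw [hu, he]⟩
    | succ n ih =>
      refine Submodule.span_le.2 ?_
      rintro _ ⟨z, hz, rfl⟩
      obtain ⟨a, z, rfl⟩ := List.exists_cons_of_length_eq_add_one hz
      have hz' : z.length = n := by simpa using hz
      rw [SetLike.mem_coe, hu]
      exact hstep _ a _ (ih (Submodule.subset_span ⟨z, hz', rfl⟩))
  have hnil : ∀ n, u [] ∈ V n := by
    intro n
    induction n with
    | zero => exact Submodule.subset_span ⟨[], rfl, rfl⟩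
    | succ n ih => exact hmono n ih
  have := Submodule.eq_top_of_stable V hmono fun n hn =>
    htop (V n) (hnil n) fun a w hw => hn ▸ hstep n a w hw
  rwa [Module.finrank_fin_fun] at this

/-- A spanning family of vectors in `ℝ ^ K` contains the rows of an invertible matrix. -/
lemma Matrix.exists_isUnit_of_span_eq_top {I : Type*} (u : I → Fin K → ℝ) (s : Set I)
    (h : Submodule.span ℝ (u '' s) = ⊤) :
    ∃ w : Fin K → I, (∀ i, w i ∈ s) ∧ IsUnit (Matrix.of fun i => u (w i)) := by
  obtain ⟨f, hf, -, hli⟩ := Submodule.exists_fun_fin_finrank_span_eq ℝ (u '' s)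
  have hK : Module.finrank ℝ (Submodule.span ℝ (u '' s)) = K := by
    rw [h, finrank_top, Module.finrank_fin_fun]
  choose w hw hwf using hf
  refine ⟨fun i => w (i.cast hK.symm), fun i => hw _, ?_⟩
  rw [← linearIndependent_rows_iff_isUnit]
  have : (Matrix.of fun i => u (w (Fin.cast hK.symm i))).row = f ∘ Fin.cast hK.symm := by
    funext i
    exact hwf _
  rw [this]
  exact hli.comp _ (Fin.cast_injective _)

end LinearAlgebra

/-! ### Minimal realizations and their intertwiners -/

section Realization

variable {K : ℕ} {ι : Type*}

/-- An invariant `W` satisfies `Γ W = W`, because the letter `e` acts as `Γ`. Each `w ∈ W` is then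
`Γ u` with `u ∈ W`, so `d a * w = diagonal (d a) * Γ` applied to `u` lies in `W`. -/
lemma Matrix.span_forward_words_eq_top {Γ : Matrix (Fin K) (Fin K) ℝ} (hΓ : IsUnit Γ)
    (hΓ1 : Γ *ᵥ 1 = 1) {d : ι → Fin K → ℝ} (hsep : ∀ i j, i ≠ j → ∃ a, d a i ≠ d a j)
    {e : ι} (he : d e = 1) :
    Submodule.span ℝ ((fun w : List ι => (w.map fun a => diagonal (d a) * Γ).prod *ᵥ 1) ''
      {w | w.length = K}) = ⊤ := by
  refine span_words_eq_top (fun a => diagonal (d a) * Γ) _ (fun a w => ?_) e ?_ ?_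
  · simp [mulVec_mulVec]
  · simp [he, hΓ1]
  · intro W h1 hW
    refine Submodule.eq_top_of_mul_mem hsep (v := 1) (fun k => one_ne_zero)
      (by simpa using h1) fun a w hw => ?_
    have hΓW : ∀ w ∈ W, Γ *ᵥ w ∈ W := fun w hw => by simpa [he] using hW e w hw
    obtain ⟨u, hu, rfl⟩ := exists_mulVec_eq_of_mapsTo hΓ hΓW hw
    have := hW a u hu
    rw [← mulVec_mulVec] at this
    convert this using 1
    ext k
    simp [mulVec_diagonal]

/-- The transposed argument: `Γᵀ` maps `W` bijectively onto itself and can be stripped from `Γᵀ (d a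
* w) ∈ W`. The nowhere vanishing vector is now `p`. Words are reversed because a new letter
multiplies on the right. -/
lemma Matrix.span_backward_words_eq_top {Γ : Matrix (Fin K) (Fin K) ℝ} (hΓ : IsUnit Γ)
    {p : Fin K → ℝ} (hp : p ᵥ* Γ = p) (hp0 : ∀ k, p k ≠ 0)
    {d : ι → Fin K → ℝ} (hsep : ∀ i j, i ≠ j → ∃ a, d a i ≠ d a j) {e : ι} (he : d e = 1) :
    Submodule.span ℝ ((fun w : List ι =>
        p ᵥ* (w.reverse.map fun a => diagonal (d a) * Γ).prod) ''
      {w | w.length = K}) = ⊤ := by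
  refine span_words_eq_top (fun a => (diagonal (d a) * Γ)ᵀ) _ (fun a w => ?_) e ?_ ?_
  · simp only [mulVec_transpose, vecMul_vecMul, List.reverse_cons, List.map_append,
      List.prod_append, List.map_cons, List.map_nil, List.prod_singleton]
  · simp [he, hp, mulVec_transpose]
  · intro W h1 hW
    refine Submodule.eq_top_of_mul_mem hsep hp0 (by simpa using h1) fun a w hw => ?_
    have hΓW : ∀ w ∈ W, Γᵀ *ᵥ w ∈ W := fun w hw => by simpa [he] using hW e w hw
    have hΓt : IsUnit Γᵀ := by
      rwa [isUnit_iff_isUnit_det, det_transpose, ← isUnit_iff_isUnit_det]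
    obtain ⟨u, hu, hue⟩ := exists_mulVec_eq_of_mapsTo hΓt hΓW (hW a w hw)
    rw [transpose_mul, diagonal_transpose, ← mulVec_mulVec] at hue
    rw [mulVec_injective_iff_isUnit.2 hΓt hue] at hu
    convert hu using 1
    ext k
    simp [mulVec_diagonal]

/-- Two realizations of the same word function, the first of which is minimal, are intertwined by
an invertible matrix. -/
lemma Matrix.exists_isUnit_intertwining {p p' v v' : Fin K → ℝ}
    {M M' : ι → Matrix (Fin K) (Fin K) ℝ}
    (hp : Submodule.span ℝ ((fun w : List ι => p ᵥ* (w.reverse.map M).prod) ''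
      {w | w.length = K}) = ⊤)
    (hv : Submodule.span ℝ ((fun w : List ι => (w.map M).prod *ᵥ v) '' {w | w.length = K}) = ⊤)
    (heq : ∀ w : List ι, w.length ≤ 2 * K + 1 →
      p ⬝ᵥ ((w.map M).prod *ᵥ v) = p' ⬝ᵥ ((w.map M').prod *ᵥ v')) :
    ∃ T : Matrix (Fin K) (Fin K) ℝ, IsUnit T ∧ T *ᵥ v' = v ∧ ∀ a, M a * T = T * M' a := by
  obtain ⟨w, hw, hU⟩ := exists_isUnit_of_span_eq_top _ _ hp
  obtain ⟨z, hz, hV⟩ := exists_isUnit_of_span_eq_top _ _ hv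
  set U : Matrix (Fin K) (Fin K) ℝ := .of fun i => p ᵥ* ((w i).reverse.map M).prod with hUdef
  set V : Matrix (Fin K) (Fin K) ℝ := (Matrix.of fun i => ((z i).map M).prod *ᵥ v)ᵀ with hVdef
  let U' : Matrix (Fin K) (Fin K) ℝ := .of fun i => p' ᵥ* ((w i).reverse.map M').prod
  let V' : Matrix (Fin K) (Fin K) ℝ := (Matrix.of fun i => ((z i).map M').prod *ᵥ v')ᵀ
  replace hV : IsUnit V := by
    rwa [hVdef, isUnit_iff_isUnit_det, det_transpose, ← isUnit_iff_isUnit_det]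
  have hmul : ∀ l : List ι, l.length ≤ 1 →
      U * (l.map M).prod * V = U' * (l.map M').prod * V' := by
    intro l hl
    ext i j
    -- Prefix and suffix have length `K` and the middle at most one letter, whence the bound `2 * K
    -- + 1`.
    have key := heq ((w i).reverse ++ l ++ z j) (by
      have h1 : (w i).length = K := hw i
      have h2 : (z j).length = K := hz j
      simp only [List.length_append, List.length_reverse]
      omega)
    rw [mul_mul_apply, mul_mul_apply]
    change (p ᵥ* ((w i).reverse.map M).prod) ⬝ᵥ ((l.map M).prod *ᵥ (((z j).map M).prod *ᵥ v)) =
      (p' ᵥ* ((w i).reverse.map M').prod) ⬝ᵥ ((l.map M').prod *ᵥ (((z j).map M').prod *ᵥ v'))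
    simpa only [List.map_append, List.prod_append, ← mulVec_mulVec, dotProduct_mulVec p,
      dotProduct_mulVec p'] using key
  have hUV : U * V = U' * V' := by simpa using hmul [] (by simp)
  have hUMV : ∀ a, U * M a * V = U' * M' a * V' := fun a => by simpa using hmul [a] (by simp)
  -- Minimality passes to the second realization, since the two products agree.
  have hdet : IsUnit (U' * V') := hUV ▸ hU.mul hV
  have hU' : IsUnit U' := by
    rw [isUnit_iff_isUnit_det, det_mul] at hdet
    rw [isUnit_iff_isUnit_det]
    exact isUnit_of_mul_isUnit_left hdet
  have hV' : IsUnit V' := by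
    rw [isUnit_iff_isUnit_det, det_mul] at hdet
    rw [isUnit_iff_isUnit_det]
    exact isUnit_of_mul_isUnit_right hdet
  have hUvec : U *ᵥ v = U' *ᵥ v' := by
    ext i
    have key := heq (w i).reverse (by
      have h1 : (w i).length = K := hw i
      simp only [List.length_reverse]
      omega)
    rw [dotProduct_mulVec, dotProduct_mulVec] at key
    exact key
  obtain ⟨T, hT⟩ : ∃ T, U * T = U' := ⟨U⁻¹ * U', by
    rw [← Matrix.mul_assoc, mul_nonsing_inv _ ((isUnit_iff_isUnit_det _).1 hU), Matrix.one_mul]⟩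
  have hTV : T * V' = V := hU.mul_left_cancel (by rw [← Matrix.mul_assoc, hT, hUV])
  refine ⟨T, ?_, ?_, fun a => ?_⟩
  · rw [← hT, isUnit_iff_isUnit_det, det_mul] at hU'
    rw [isUnit_iff_isUnit_det]
    exact isUnit_of_mul_isUnit_right hU'
  · apply mulVec_injective_iff_isUnit.2 hU
    rw [mulVec_mulVec, hT, hUvec]
  · apply hU.mul_left_cancel
    apply hV'.mul_right_cancel
    calc U * (M a * T) * V' = U * M a * (T * V') := by simp only [Matrix.mul_assoc]
      _ = U * T * M' a * V' := by rw [hTV, hUMV, hT]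
      _ = U * (T * M' a) * V' := by simp only [Matrix.mul_assoc]

/-- An invertible matrix with row sums `1` intertwining two point-separating families of diagonal
matrices is a permutation matrix. -/
lemma Matrix.exists_perm_of_diagonal_intertwining {T : Matrix (Fin K) (Fin K) ℝ} (hT : IsUnit T)
    (hT1 : T *ᵥ 1 = 1) {d d' : ι → Fin K → ℝ} (hsep : ∀ i j, i ≠ j → ∃ a, d a i ≠ d a j)
    (hsep' : ∀ i j, i ≠ j → ∃ a, d' a i ≠ d' a j)
    (hd : ∀ a, diagonal (d a) * T = T * diagonal (d' a)) :
    ∃ σ : Equiv.Perm (Fin K), (∀ j k, T j k = if j = σ k then 1 else 0) ∧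
      ∀ a k, d' a k = d a (σ k) := by
  have heq : ∀ j k, T j k ≠ 0 → ∀ a, d a j = d' a k := by
    intro j k hjk a
    have := congrFun (congrFun (hd a) j) k
    rw [diagonal_mul, mul_diagonal, mul_comm] at this
    exact mul_left_cancel₀ hjk this
  -- `T` is injective, so no column vanishes.
  have hcol : ∀ k, ∃ j, T j k ≠ 0 := by
    intro k
    by_contra! h
    have : T *ᵥ Pi.single k 1 = T *ᵥ 0 := by
      ext j
      simp [h]
    have := congrFun (mulVec_injective_iff_isUnit.2 hT this) k
    simp at this
  choose s hs using hcol
  have hinj : Function.Injective s := by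
    intro k l hkl
    by_contra hne
    obtain ⟨a, ha⟩ := hsep' k l hne
    exact ha (by rw [← heq _ _ (hs k) a, ← heq _ _ (hs l) a, hkl])
  have hzero : ∀ j k, j ≠ s k → T j k = 0 := by
    intro j k hne
    by_contra h
    obtain ⟨a, ha⟩ := hsep j (s k) hne
    exact ha (by rw [heq _ _ h a, heq _ _ (hs k) a])
  refine ⟨Equiv.ofBijective s (Finite.injective_iff_bijective.1 hinj), fun j k => ?_,
    fun a k => (heq _ _ (hs k) a).symm⟩
  rw [Equiv.ofBijective_apply]
  split_ifs with h
  -- Row `s k` has a single nonzero entry, which must equal the row sum `1`.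
  · subst h
    have := congrFun hT1 (s k)
    simp only [mulVec, dotProduct, Pi.one_apply, mul_one] at this
    rwa [Finset.sum_eq_single k (fun l _ hl => hzero _ _ fun h => hl (hinj h).symm)
      (by simp)] at this
  · exact hzero j k h

/-- The word function of a stochastic matrix and a point-separating family of emission
probabilities, on words of length at most `2 * K + 1`, determines both up to label swapping. -/
lemma Matrix.exists_perm_of_word_function_eq {Γ Γ' : Matrix (Fin K) (Fin K) ℝ}
    (hΓ : IsUnit Γ) (hΓ' : IsUnit Γ') (hΓ1 : Γ *ᵥ 1 = 1)
    {p p' : Fin K → ℝ} (hp : p ᵥ* Γ = p) (hp0 : ∀ k, p k ≠ 0)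
    {d d' : ι → Fin K → ℝ} (hsep : ∀ i j, i ≠ j → ∃ a, d a i ≠ d a j)
    (hsep' : ∀ i j, i ≠ j → ∃ a, d' a i ≠ d' a j) {e : ι} (he : d e = 1) (he' : d' e = 1)
    (heq : ∀ w : List ι, w.length ≤ 2 * K + 1 →
      p ⬝ᵥ ((w.map fun a => diagonal (d a) * Γ).prod *ᵥ 1) =
        p' ⬝ᵥ ((w.map fun a => diagonal (d' a) * Γ').prod *ᵥ 1)) :
    ∃ σ : Equiv.Perm (Fin K), (∀ j k, Γ' j k = Γ (σ j) (σ k)) ∧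
      ∀ a k, d' a k = d a (σ k) := by
  obtain ⟨T, hT, hT1, hTM⟩ := exists_isUnit_intertwining
    (span_backward_words_eq_top hΓ hp hp0 hsep he)
    (span_forward_words_eq_top hΓ hΓ1 hsep he) heq
  have hΓT : Γ * T = T * Γ' := by simpa [he, he'] using hTM e
  have hdT : ∀ a, diagonal (d a) * T = T * diagonal (d' a) := by
    intro a
    apply hΓ'.mul_right_cancel
    rw [Matrix.mul_assoc, ← hΓT, ← Matrix.mul_assoc, hTM a, Matrix.mul_assoc]
  obtain ⟨σ, hσ, hd⟩ := exists_perm_of_diagonal_intertwining hT hT1 hsep hsep' hdT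
  refine ⟨σ, fun j k => ?_, hd⟩
  have := congrFun (congrFun hΓT (σ j)) k
  simpa [Matrix.mul_apply, hσ] using this.symm

end Realization

/-! ### From the model assumptions to the algebraic hypotheses -/

section Identification

variable {K : ℕ}

/-- Some state `i` has positive mass, and a power of `Γ`, which also fixes `p`, carries part of it
to `j`. -/
lemma IsStationaryDistribution.pos {Γ : Matrix (Fin K) (Fin K) ℝ} {p : Fin K → ℝ}
    (h : IsStationaryDistribution Γ p) (hΓ : Γ.IsIrreducible) (j : Fin K) : 0 < p j := by
  obtain ⟨i, hi⟩ : ∃ i, 0 < p i := by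
    by_contra! hle
    have : ∑ k, p k ≤ 0 := Finset.sum_nonpos fun k _ => hle k
    linarith [h.sum_eq_one]
  obtain ⟨n, -, hn⟩ := (isIrreducible_iff_exists_pow_pos hΓ.nonneg).1 hΓ i j
  have hpow : ∀ n, p ᵥ* Γ ^ n = p := by
    intro n
    induction n with
    | zero => simp
    | succ n ih => rw [pow_succ, ← vecMul_vecMul, ih, h.vecMul_eq]
  have hnonneg : ∀ k, 0 ≤ (Γ ^ n) k j := fun k => Matrix.pow_apply_nonneg hΓ.nonneg n k j
  rw [← hpow n]
  exact Finset.sum_pos' (fun k _ => mul_nonneg (h.nonneg k) (hnonneg k))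
    ⟨i, Finset.mem_univ i, mul_pos hi hn⟩

lemma Matrix.isUnit_of_rank_eq {A : Matrix (Fin K) (Fin K) ℝ} (hA : A.rank = K) : IsUnit A := by
  rw [← mulVec_injective_iff_isUnit]
  have hr : A.mulVecLin.range = ⊤ :=
    Submodule.eq_top_of_finrank_eq (by rw [Module.finrank_fin_fun]; exact hA)
  exact LinearMap.injective_iff_surjective.2 (LinearMap.range_eq_top.1 hr)

lemma exists_measureReal_ne_of_injective {S : Type*} [MeasurableSpace S] {F : Fin K → Measure S}
    (hprob : ∀ k, IsProbabilityMeasure (F k)) (hF : Function.Injective F) (i j : Fin K)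
    (hij : i ≠ j) : ∃ A : {A : Set S // MeasurableSet A}, (F i).real A ≠ (F j).real A := by
  by_contra! h
  refine hij (hF (Measure.ext fun A hA => ?_))
  exact (measureReal_eq_measureReal_iff).1 (h ⟨A, hA⟩)

end Identification

end

theorem mainTheorem2 {K q : ℕ} (S : Set (EuclideanSpace ℝ (Fin q)))
    {Ω Ω' : Type*} [MeasurableSpace Ω] [MeasurableSpace Ω']
    (μ : Measure Ω) (μ' : Measure Ω') [IsProbabilityMeasure μ] [IsProbabilityMeasure μ']
    (X : ℕ → Ω → Fin K) (Y : ℕ → Ω → S) (X' : ℕ → Ω' → Fin K) (Y' : ℕ → Ω' → S)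
    (Γ Γ' : Matrix (Fin K) (Fin K) ℝ) (F F' : Fin K → Measure S)
    (hmm : IsHiddenMarkovModel Γ F μ X Y) (hmm' : IsHiddenMarkovModel Γ' F' μ' X' Y')
    (hΓ : FullRankErgodic Γ) (hΓ' : FullRankErgodic Γ')
    (hF : Function.Injective F) (hF' : Function.Injective F')
    (hstat : StartsStationary Γ μ X) (hstat' : StartsStationary Γ' μ' X')
    (hlaw : μ.map (fun ω (i : Fin (2 * K + 1)) => Y i ω) =
      μ'.map (fun ω (i : Fin (2 * K + 1)) => Y' i ω)) :
    EqualUpToLabelSwapping Γ F Γ' F' := by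
  have hprob := hmm.isProbabilityMeasure
  have hprob' := hmm'.isProbabilityMeasure
  -- The letters are the measurable sets, and the whole space serves as the neutral letter `e`.
  obtain ⟨σ, hσΓ, hσF⟩ := Matrix.exists_perm_of_word_function_eq
    (Matrix.isUnit_of_rank_eq hΓ.1) (Matrix.isUnit_of_rank_eq hΓ'.1)
    hmm.markovChain.stochastic.2 hstat.vecMul_eq (fun k => (hstat.pos hΓ.2.1 k).ne')
    (d := fun (A : {A : Set S // MeasurableSet A}) k => (F k).real A)
    (d' := fun A k => (F' k).real A)
    (exists_measureReal_ne_of_injective hprob hF)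
    (exists_measureReal_ne_of_injective hprob' hF')
    (e := ⟨Set.univ, .univ⟩) (by ext k; simp) (by ext k; simp)
    fun w hw => by
      have h := hmm.map_measureReal_eq_dotProduct w hw
      rw [hlaw, hmm'.map_measureReal_eq_dotProduct w hw] at h
      exact h.symm
  refine ⟨σ, hσΓ, fun k => Measure.ext fun A hA => ?_⟩
  exact (measureReal_eq_measureReal_iff).1 (hσF ⟨A, hA⟩ k)
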